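/- Let $V$ be a finite non-empty set of $n$ nodes and let $E_n$ be the edge set of the complete graph $K_n$ on $V$. A tour is a multiset of edges of $K_n$ that forms a connected spanning multigraph on $V$ with all degrees even; its incidence vector in $\mathbb{R}^{E_n}$ gives the multiplicity of each edge. Let $T^n\subseteq\mathbb{R}^{E_n}$ be the convex hull of the incidence vectors of all tours. Let $S^n$ be the set of all $x\in\mathbb{R}^{E_n}$ with $x(\delta(v))=2$ for all $v\in V$, $x(\delta(S))\ge 2$ for all $\emptyset\ne S\subsetneq V$, and $0\le x_e\le 1$ for all $e\in E_n$, where $\delta(S)$ is the set of edges of $K_n$ with exactly one end in $S$, and $\delta(v)=\delta(\{v\})$. The support graph of $x\in S^n$ is the graph on $V$ with edge set $\{e\in E_n: x_e>0\}$. A point $x\in S^n$ is a Boyd–Carr point (respectively, a Carr–Vempala point) if its support graph is cubic, each node is incident to exactly one edge $e$ with $x_e=1$, and the edges $e$ with $0<x_e<1$ form disjoint $4$-cycles (respectively, a Hamiltonian cycle). A fundamental graph is the support graph of a Boyd–Carr point or of a Carr–Vempala point. Theorem. If $G=(V,E)$ is a (simple) cubic, $3$-edge-connected Hamiltonian graph,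 then the vector $y\in\mathbb{R}^{E_n}$ with $y_e=6/7$ for $e\in E$ and $y_e=0$ for $e\in E_n\setminus E$ belongs to $T^n$. This applies in particular to $3$-edge-connected fundamental graphs: every such graph is cubic and Hamiltonian, and hence its everywhere $6/7$ vector $y$ belongs to $T^n$. -/

import Mathlib

namespace TSP

/-- The edge set `E_n` of the complete graph on the finite node set `V` (with `n = |V|`). -/
abbrev KEdge (V : Type*) : Type _ := (⊤ : SimpleGraph V).edgeSet

section Tours

variable {V : Type*} [Fintype V] [DecidableEq V]

/-- The subgraph of the complete graph formed by the edges with a property `P`. -/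
def graphOf (P : KEdge V → Prop) : SimpleGraph V :=
  SimpleGraph.fromEdgeSet {e | ∃ h : e ∈ (⊤ : SimpleGraph V).edgeSet, P ⟨e, h⟩}

/-- A multiset of edges of the complete graph, given by its multiplicity function `J`, is a tour
if the multigraph on all of `V` that it forms is connected and has all degrees even. -/
def IsTour (J : KEdge V → ℕ) : Prop :=
  (graphOf fun e => 0 < J e).Connected ∧
    ∀ v : V, Even (∑ e : KEdge V with v ∈ e.1, J e)

/-- The incidence vector of a multiset of edges. -/
def incidenceVector (J : KEdge V → ℕ) : KEdge V → ℝ := fun e => (J e : ℝ)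

variable (V) in
/-- The polyhedron `T^n`: the convex hull of the incidence vectors of the tours. -/
def tourPolyhedron : Set (KEdge V → ℝ) :=
  convexHull ℝ {y | ∃ J : KEdge V → ℕ, IsTour J ∧ y = incidenceVector J}

open Classical in
/-- The everywhere `r` vector for `G`: value `r` on the edges of `G` and `0` on all the others. -/
noncomputable def everywhereVector (G : SimpleGraph V) (r : ℝ) : KEdge V → ℝ :=
  fun e => if e.1 ∈ G.edgeSet then r else 0

open Classical in
/-- Every node has degree `3`. -/
def IsCubic (G : SimpleGraph V) : Prop := G.IsRegularOfDegree 3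

end Tours

section FundamentalPoints

variable {V : Type*} [Fintype V] [DecidableEq V]

variable (V) in
/-- The subtour elimination polytope `S^n`. -/
def subtourPolytope : Set (KEdge V → ℝ) :=
  {x | (∀ v : V, ∑ e : KEdge V with v ∈ e.1, x e = 2) ∧
    (∀ S : Finset V, S.Nonempty → S ≠ Finset.univ →
      2 ≤ ∑ e : KEdge V with ∃ u ∈ S, ∃ w ∈ Sᶜ, e.1 = s(u, w), x e) ∧
    ∀ e, 0 ≤ x e ∧ x e ≤ 1}

/-- The support graph of `x`. -/
def supportGraph (x : KEdge V → ℝ) : SimpleGraph V := graphOf fun e => 0 < x e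

/-- The graph of the fractional edges of `x`. -/
def fractionalGraph (x : KEdge V → ℝ) : SimpleGraph V := graphOf fun e => 0 < x e ∧ x e < 1

/-- The common part of the two kinds of fundamental points: a point of `S^n` with cubic support
graph in which there is exactly one `1`-edge incident to each node. -/
def HasCubicSupportWithMatching (x : KEdge V → ℝ) : Prop :=
  x ∈ subtourPolytope V ∧ IsCubic (supportGraph x) ∧
    ∀ v : V, ∃! e : KEdge V, v ∈ e.1 ∧ x e = 1

/-- Boyd-Carr points: in addition, the fractional edges form disjoint `4`-cycles (which cover all
nodes, since each node is incident to exactly two fractional edges). -/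
def IsBoydCarrPoint (x : KEdge V → ℝ) : Prop :=
  HasCubicSupportWithMatching x ∧
    ∀ c : (fractionalGraph x).ConnectedComponent,
      Nonempty (c.toSimpleGraph ≃g SimpleGraph.cycleGraph 4)

/-- Carr-Vempala points: in addition, the fractional edges form a Hamiltonian cycle. -/
def IsCarrVempalaPoint (x : KEdge V → ℝ) : Prop :=
  HasCubicSupportWithMatching x ∧
    ∃ (a : V) (p : (fractionalGraph x).Walk a a),
      p.IsHamiltonianCycle ∧ ∀ e ∈ (fractionalGraph x).edgeSet, e ∈ p.edges

/-- A fundamental graph is the support graph of a Boyd-Carr or of a Carr-Vempala point. -/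
def IsFundamentalGraph (G : SimpleGraph V) : Prop :=
  ∃ x : KEdge V → ℝ, (IsBoydCarrPoint x ∨ IsCarrVempalaPoint x) ∧ G = supportGraph x

end FundamentalPoints

end TSP

/-!
Let `H` be a Hamiltonian cycle of the cubic `3`-edge-connected graph `G`, and let `x` be the vector
with value `1 / 2` on `H`, `1` on the other edges of `G`, and `0` elsewhere (`halfVector`). Since a
cut has at least `3` edges of `G` and an even number of them in `H`, the vector `x` has value at
least `2` on every cut. The everywhere `6 / 7` vector of `G` is the convex combination
`3 / 7 * H + 4 / 7 * (3 / 2 * x)`. As `H` is a tour, it remains to show that `3 / 2 * x` is in the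
tour polyhedron, which is the classical analysis of Christofides' heuristic: `x` dominates a convex
combination of connected spanning edge sets, and `x / 2` dominates, for every even set `T`, a convex
combination of `T`-joins.

All of this is done for one cost function at a time. By separation of a point from a polyhedron
(`mem_tourPolyhedron_of_forall_cost`) it suffices that every nonnegative cost function has a tour
that costs at most as much as the given vector. For a fixed cost function, the connecting set is
found greedily (`exists_connecting_le`), and the `T`-join is given by the theorem of Edmonds and
Johnson (`exists_join_le`), which is proved here through Seymour's lemma
(`exists_node_forall_min_join`): if all weights are positive and `T` is not empty, then some node
of `T` is incident to exactly one edge of each minimum weight `T`-join. So the weights of the edges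
at that node can be lowered a little, and edges of weight `0` are contracted. Both results are
proved for multigraphs, given by two end maps `s t : E → W`, in order to allow contractions.

Fundamental graphs are cubic by definition. For Carr-Vempala points, the Hamiltonian cycle is part
of the definition. For Boyd-Carr points, take all `1`-edges and one of the two perfect matchings of
each fractional `4`-cycle. This gives a `2`-regular graph, and if it is not connected, then some
`4`-cycle meets two of its components, which are merged by switching the matching of this `4`-cycle
(`isHamiltonian_of_matching_of_fourCycles`).
-/

set_option linter.unusedSectionVars false

namespace TSP

/-! ### Cuts, contractions and spanning connected edge sets -/

section Multigraph

variable {E W : Type*} [Fintype E] [DecidableEq E] [Fintype W] [DecidableEq W]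

/-- The cut `δ(S)` of a multigraph given by the two end maps `s` and `t` of its edges. -/
def cut (s t : E → W) (S : Finset W) : Finset E := {e | ¬(s e ∈ S ↔ t e ∈ S)}

lemma mem_cut {s t : E → W} {S : Finset W} {e : E} :
    e ∈ cut s t S ↔ ¬(s e ∈ S ↔ t e ∈ S) := by simp [cut]

lemma cut_comp {W' : Type*} [Fintype W'] [DecidableEq W'] (s t : E → W) (π : W → W')
    (S : Finset W') :
    cut (π ∘ s) (π ∘ t) S = cut s t {v | π v ∈ S} := by
  ext e; simp [mem_cut]

lemma mem_cut_singleton_ends {s t : E → W} {b : W} {e : E} (he : e ∈ cut s t {b}) :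
    ∃ c, c ≠ b ∧ ((s e = b ∧ t e = c) ∨ (s e = c ∧ t e = b)) := by
  rw [mem_cut] at he
  simp only [Finset.mem_singleton] at he
  by_cases h : s e = b
  · exact ⟨t e, by tauto, Or.inl ⟨h, rfl⟩⟩
  · exact ⟨s e, h, Or.inr ⟨rfl, by tauto⟩⟩

lemma ne_of_mem_cut {s t : E → W} {S : Finset W} {e : E} (he : e ∈ cut s t S) : s e ≠ t e := by
  intro h
  rw [mem_cut, h] at he
  exact he Iff.rfl

/-- The map that identifies the node `b` with the node `a`. -/
def contractMap {a b : W} (hab : a ≠ b) (v : W) : {v : W // v ≠ b} :=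
  if h : v = b then ⟨a, hab⟩ else ⟨v, h⟩

lemma contractMap_eq {a b : W} (hab : a ≠ b) (v : W) :
    (contractMap hab v : W) = if v = b then a else v := by
  unfold contractMap; split_ifs <;> rfl

lemma contractMap_eq_iff {a b : W} (hab : a ≠ b) (v w : W) :
    contractMap hab v = contractMap hab w ↔
      v = w ∨ (v = a ∧ w = b) ∨ (v = b ∧ w = a) := by
  rw [Subtype.ext_iff, contractMap_eq, contractMap_eq]
  split_ifs <;> grind

lemma contractMap_surjective {a b : W} (hab : a ≠ b) :
    Function.Surjective (contractMap hab) := by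
  rintro ⟨v, hv⟩
  exact ⟨v, by simp [contractMap, hv]⟩

lemma card_contract (b : W) : Fintype.card {v : W // v ≠ b} + 1 = Fintype.card W := by
  have : 0 < Fintype.card W := Fintype.card_pos_iff.2 ⟨b⟩
  simp [Fintype.card_subtype_compl]
  omega

/-- A set of edges is connecting if it meets every cut, that is, if it forms a connected spanning
multigraph. -/
def Connecting (s t : E → W) (F : Finset E) : Prop :=
  ∀ S : Finset W, S.Nonempty → S ≠ Finset.univ → ∃ e ∈ F, e ∈ cut s t S

/-- The cut lower bounds survive every contraction, since a cut of the contracted multigraph is a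
cut of the original one. -/
lemma cut_bound_contract {s t : E → W} {x : E → ℝ} {r : ℝ} {W' : Type*} [Fintype W']
    [DecidableEq W'] {π : W → W'} (hπ : Function.Surjective π)
    (hx : ∀ S : Finset W, S.Nonempty → S ≠ Finset.univ → r ≤ ∑ e ∈ cut s t S, x e)
    (S : Finset W') (hS : S.Nonempty) (hS' : S ≠ Finset.univ) :
    r ≤ ∑ e ∈ cut (π ∘ s) (π ∘ t) S, x e := by
  rw [cut_comp]
  apply hx
  · obtain ⟨v', hv'⟩ := hS
    obtain ⟨v, rfl⟩ := hπ v'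
    exact ⟨v, by simpa using hv'⟩
  · intro h
    apply hS'
    rw [Finset.eq_univ_iff_forall] at h ⊢
    intro v'
    obtain ⟨v, rfl⟩ := hπ v'
    simpa using h v

/-- Contracting an edge and putting it back preserves being connecting. -/
lemma Connecting.insert_of_contract {s t : E → W} {e₀ : E} (h₀ : s e₀ ≠ t e₀) {F : Finset E}
    (hF : Connecting (contractMap h₀ ∘ s) (contractMap h₀ ∘ t) F) :
    Connecting s t (insert e₀ F) := by
  intro S hS hS'
  by_cases he : e₀ ∈ cut s t S
  · exact ⟨e₀, by simp, he⟩
  have hab : s e₀ ∈ S ↔ t e₀ ∈ S := by simpa [mem_cut] using he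
  -- `S` does not separate the ends of `e₀`, so it is a union of fibres of the contraction.
  have hpre : Finset.univ.filter (fun v => contractMap h₀ v ∈ S.image (contractMap h₀)) = S := by
    ext v
    simp only [Finset.mem_filter, Finset.mem_univ, true_and, Finset.mem_image, contractMap_eq_iff]
    constructor
    · rintro ⟨w, hw, rfl | ⟨rfl, rfl⟩ | ⟨rfl, rfl⟩⟩ <;> tauto
    · intro hv
      exact ⟨v, hv, Or.inl rfl⟩
  obtain ⟨e, heF, hec⟩ := hF (S.image (contractMap h₀)) (hS.image _) (by
    intro h
    apply hS'
    rw [← hpre, h]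
    simp)
  rw [cut_comp, hpre] at hec
  exact ⟨e, Finset.mem_insert_of_mem heF, hec⟩

/-- If every star has value at least `2`, then the non-loops have total value at least the number
of nodes. -/
lemma card_le_sum_nonloops {s t : E → W} {x : E → ℝ}
    (hx : ∀ v, 2 ≤ ∑ e ∈ cut s t {v}, x e) :
    (Fintype.card W : ℝ) ≤ ∑ e with s e ≠ t e, x e := by
  have h1 : ∑ v : W, ∑ e ∈ cut s t {v}, x e = 2 * ∑ e with s e ≠ t e, x e := by
    simp only [cut, Finset.sum_filter, Finset.mem_singleton]
    rw [Finset.sum_comm, Finset.mul_sum]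
    refine Finset.sum_congr rfl fun e _ => ?_
    by_cases h : s e = t e
    · simp [h]
    · rw [if_pos h]
      have : ∀ v, (if ¬(s e = v ↔ t e = v) then x e else 0) =
          (if s e = v then x e else 0) + (if t e = v then x e else 0) := by
        intro v
        split_ifs <;> grind
      simp only [this, Finset.sum_add_distrib, Finset.sum_ite_eq, Finset.mem_univ, if_true]
      ring
  have h2 : ∑ _v : W, (2 : ℝ) ≤ ∑ v : W, ∑ e ∈ cut s t {v}, x e :=
    Finset.sum_le_sum fun v _ => hx v
  simp at h2
  linarith

/-- **Spanning trees.** If `x ≥ 0` has value at least `2` on every cut, then for all weights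
`w ≥ 0` some connecting set of edges has weight at most `w · x`. The set is built greedily:
contract an edge of smallest weight, and lower all weights by that amount. -/
theorem exists_connecting_le {W : Type*} [Fintype W] [DecidableEq W] [Nonempty W]
    (s t : E → W) (x w : E → ℝ) (hx0 : 0 ≤ x) (hw : 0 ≤ w)
    (hx : ∀ S : Finset W, S.Nonempty → S ≠ Finset.univ → 2 ≤ ∑ e ∈ cut s t S, x e) :
    ∃ F : Finset E, Connecting s t F ∧ F.card + 1 ≤ Fintype.card W ∧ (∀ e ∈ F, s e ≠ t e) ∧
      ∑ e ∈ F, w e ≤ ∑ e, w e * x e := by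
  obtain ⟨n, hn⟩ : ∃ n, Fintype.card W = n := ⟨_, rfl⟩
  induction n generalizing W w with
  | zero => exact absurd hn Fintype.card_ne_zero
  | succ n ih =>
    by_cases h1 : Fintype.card W ≤ 1
    · have := Fintype.card_le_one_iff_subsingleton.1 h1
      refine ⟨∅, fun S hS hS' => (hS' ?_).elim, ?_, by simp, ?_⟩
      · obtain ⟨v, hv⟩ := hS
        exact Finset.eq_univ_iff_forall.2 fun u => Subsingleton.elim v u ▸ hv
      · simpa [Nat.succ_le_iff] using Fintype.card_pos (α := W)
      · simpa using Finset.sum_nonneg fun e _ => mul_nonneg (hw e) (hx0 e)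
    have hnt : Nontrivial W := Fintype.one_lt_card_iff_nontrivial.1 (not_le.1 h1)
    have hstar : ∀ v, 2 ≤ ∑ e ∈ cut s t {v}, x e := fun v => hx {v} (by simp) (by
      intro h
      obtain ⟨u, hu⟩ := exists_ne v
      exact hu (by simpa [← h] using Finset.mem_univ u))
    have hcard := card_le_sum_nonloops hstar
    have hne : (Finset.univ.filter fun e => s e ≠ t e).Nonempty := by
      by_contra h
      rw [Finset.not_nonempty_iff_eq_empty] at h
      rw [h] at hcard
      have : (1 : ℝ) < Fintype.card W := by exact_mod_cast not_le.1 h1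
      rw [Finset.sum_empty] at hcard
      linarith
    obtain ⟨e₀, he₀, hmin⟩ := Finset.exists_min_image _ w hne
    have h₀ : s e₀ ≠ t e₀ := by simpa using he₀
    have hmin' : ∀ e, s e ≠ t e → w e₀ ≤ w e := fun e he => hmin e (by simpa using he)
    have hcW := card_contract (t e₀)
    have : Nonempty {v : W // v ≠ t e₀} := ⟨⟨s e₀, h₀⟩⟩
    obtain ⟨F, hF, hFc, hFl, hFw⟩ := ih (contractMap h₀ ∘ s) (contractMap h₀ ∘ t)
      (fun e => if s e = t e then 0 else w e - w e₀)
      (fun e => by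
        by_cases he : s e = t e
        · simp [he]
        · simpa [he] using hmin' e he)
      (cut_bound_contract (contractMap_surjective h₀) hx) (by omega)
    have hFl' : ∀ e ∈ F, s e ≠ t e := fun e he h => hFl e he (by simp [h])
    have he₀F : e₀ ∉ F := fun h => hFl e₀ h (by simp [contractMap_eq_iff])
    refine ⟨insert e₀ F, hF.insert_of_contract h₀, ?_, ?_, ?_⟩
    · rw [Finset.card_insert_of_notMem he₀F]; omega
    · intro e he
      rcases Finset.mem_insert.1 he with rfl | he
      · exact h₀
      · exact hFl' e he
    · rw [Finset.sum_insert he₀F]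
      have e1 : ∑ e ∈ F, (if s e = t e then 0 else w e - w e₀) =
          ∑ e ∈ F, w e - F.card * w e₀ := by
        rw [Finset.sum_congr rfl fun e he => if_neg (hFl' e he)]
        simp
      have e2 : ∑ e, (if s e = t e then 0 else w e - w e₀) * x e =
          ∑ e with s e ≠ t e, w e * x e - w e₀ * ∑ e with s e ≠ t e, x e := by
        rw [Finset.mul_sum, ← Finset.sum_sub_distrib, Finset.sum_filter]
        refine Finset.sum_congr rfl fun e _ => ?_
        by_cases he : s e = t e
        · simp [he]
        · simp only [he, if_false, ne_eq, not_false_eq_true, if_true]; ring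
      have e3 : ∑ e with s e ≠ t e, w e * x e ≤ ∑ e, w e * x e :=
        Finset.sum_le_sum_of_subset_of_nonneg (Finset.filter_subset _ _)
          fun e _ _ => mul_nonneg (hw e) (hx0 e)
      have e4 : w e₀ * (F.card + 1) ≤ w e₀ * ∑ e with s e ≠ t e, x e := by
        refine mul_le_mul_of_nonneg_left (le_trans ?_ hcard) (hw e₀)
        have : F.card + 1 ≤ Fintype.card W := by omega
        exact_mod_cast this
      rw [e1, e2] at hFw
      nlinarith

end Multigraph

/-! ### Joins and Seymour's lemma -/

section Joins

variable {E W : Type*} [Fintype E] [DecidableEq E] [Fintype W] [DecidableEq W]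

/-- The vector of degree parities of an edge set `J` of a multigraph, where edge sets are encoded
as vectors over `ZMod 2`. With `bdry s t J = T`, the set `J` is a `T`-join. Loops contribute `0`. -/
def bdry (s t : E → W) (J : E → ZMod 2) : W → ZMod 2 :=
  ∑ e, J e • (Pi.single (s e) 1 + Pi.single (t e) 1)

lemma zmod_two_eq_one {a : ZMod 2} (h : a ≠ 0) : a = 1 := by
  revert a; decide

lemma bdry_add (s t : E → W) (J K : E → ZMod 2) :
    bdry s t (J + K) = bdry s t J + bdry s t K := by
  simp only [bdry, Pi.add_apply, add_smul, Finset.sum_add_distrib]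

lemma bdry_zero (s t : E → W) : bdry s t 0 = 0 := by
  simp [bdry]

lemma bdry_single (s t : E → W) (e : E) (k : ZMod 2) :
    bdry s t (Pi.single e k) = k • (Pi.single (s e) 1 + Pi.single (t e) 1) := by
  unfold bdry
  rw [Finset.sum_eq_single e]
  · simp
  · intro f _ hf
    simp [Pi.single_eq_of_ne hf]
  · simp

/-- Summing degrees over `S`, only the edges of the cut `δ(S)` survive modulo `2`. -/
lemma sum_bdry (s t : E → W) (J : E → ZMod 2) (S : Finset W) :
    ∑ v ∈ S, bdry s t J v = ∑ e ∈ cut s t S, J e := by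
  simp only [bdry, Finset.sum_apply, Pi.smul_apply, Pi.add_apply, cut, Finset.sum_filter]
  rw [Finset.sum_comm]
  refine Finset.sum_congr rfl fun e _ => ?_
  rw [← Finset.smul_sum, Finset.sum_add_distrib]
  have h : ∀ a : W, ∑ v ∈ S, (Pi.single a (1 : ZMod 2) : W → ZMod 2) v =
      if a ∈ S then 1 else 0 := by
    intro a
    simp [Pi.single_apply]
  rw [h, h]
  by_cases h1 : s e ∈ S <;> by_cases h2 : t e ∈ S <;> simp [h1, h2]
  exact Or.inr (CharTwo.add_self_eq_zero 1)

lemma bdry_apply (s t : E → W) (J : E → ZMod 2) (v : W) :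
    bdry s t J v = ∑ e ∈ cut s t {v}, J e := by
  simpa using sum_bdry s t J {v}

/-- The weight of an edge set. -/
def weight (w : E → ℝ) (J : E → ZMod 2) : ℝ := ∑ e, w e * ((J e).val : ℝ)

lemma add_self_zmod {α : Type*} (f : α → ZMod 2) : f + f = 0 :=
  funext fun _ => CharTwo.add_self_eq_zero _

/-- An `{a, b}`-join contains an `{a, b}`-join with exactly one edge at `b`: walk along it
from `a` until `b` is reached. -/
lemma exists_subjoin (s t : E → W) (P : E → ZMod 2) (a b : W) (hab : a ≠ b)
    (hP : bdry s t P = Pi.single a 1 + Pi.single b 1) :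
    ∃ P' : E → ZMod 2, (∀ e, P' e ≠ 0 → P e ≠ 0) ∧
      bdry s t P' = Pi.single a 1 + Pi.single b 1 ∧
      ∑ e ∈ cut s t {b}, (P' e).val = 1 := by
  obtain ⟨n, hn⟩ : ∃ n, (Finset.univ.filter fun e => P e ≠ 0).card = n := ⟨_, rfl⟩
  induction n generalizing P a with
  | zero =>
    exfalso
    have h0 : P = 0 := by
      ext e
      simpa using (Finset.filter_eq_empty_iff.1 (Finset.card_eq_zero.1 hn)) (Finset.mem_univ e)
    have := congrFun hP a
    simp [h0, bdry_zero, Pi.single_eq_of_ne hab] at this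
  | succ n ih =>
    have h1 : ∑ e ∈ cut s t {a}, P e = 1 := by
      rw [← bdry_apply, hP]
      simp [Pi.single_eq_of_ne hab]
    obtain ⟨e, he, hPe⟩ := Finset.exists_ne_zero_of_sum_ne_zero (by rw [h1]; exact one_ne_zero)
    obtain ⟨c, hca, hc⟩ := mem_cut_singleton_ends he
    have hends : (Pi.single (s e) 1 + Pi.single (t e) 1 : W → ZMod 2) =
        Pi.single a 1 + Pi.single c 1 := by
      rcases hc with ⟨h, h'⟩ | ⟨h, h'⟩ <;> rw [h, h']
      rw [add_comm]
    by_cases hcb : c = b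
    · subst hcb
      refine ⟨Pi.single e 1, ?_, ?_, ?_⟩
      · intro f hf
        by_cases hfe : f = e
        · rwa [hfe]
        · simp [Pi.single_eq_of_ne hfe] at hf
      · rw [bdry_single, one_smul, hends]
      · have hec : e ∈ cut s t {c} := by
          rw [mem_cut]
          rcases hc with ⟨h, h'⟩ | ⟨h, h'⟩ <;> simp [h, h', Ne.symm hca]
        rw [Finset.sum_eq_single e]
        · simp [ZMod.val_one]
        · intro f _ hf
          simp [Pi.single_eq_of_ne hf]
        · exact fun h => (h hec).elim
    · have hP1 : bdry s t (P + Pi.single e 1) = Pi.single c 1 + Pi.single b 1 := by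
        rw [bdry_add, hP, bdry_single, one_smul, hends]
        have := add_self_zmod (Pi.single a 1 : W → ZMod 2)
        linear_combination this
      have hPe1 := zmod_two_eq_one hPe
      have hsupp : (Finset.univ.filter fun f => (P + Pi.single e 1 : E → ZMod 2) f ≠ 0) =
          (Finset.univ.filter fun f => P f ≠ 0).erase e := by
        ext f
        by_cases hfe : f = e
        · subst hfe
          simp [hPe1, CharTwo.add_self_eq_zero]
        · simp [hfe]
      obtain ⟨P', hsub, hbd, hone⟩ := ih (P + Pi.single e 1) c hcb hP1 (by
        rw [hsupp, Finset.card_erase_of_mem (by simpa using hPe), hn]; rfl)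
      have hP'e : P' e = 0 := by
        by_contra h
        exact hsub e h (by simp [hPe1, CharTwo.add_self_eq_zero])
      refine ⟨P' + Pi.single e 1, ?_, ?_, ?_⟩
      · intro f hf
        by_cases hfe : f = e
        · rwa [hfe]
        · have := hsub f (by simpa [Pi.single_eq_of_ne hfe] using hf)
          simpa [Pi.single_eq_of_ne hfe] using this
      · rw [bdry_add, hbd, bdry_single, one_smul, hends]
        have := add_self_zmod (Pi.single c 1 : W → ZMod 2)
        linear_combination this
      · have heb : e ∉ cut s t {b} := by
          rw [mem_cut]
          rcases hc with ⟨h, h'⟩ | ⟨h, h'⟩ <;> simp [h, h', hab, hcb]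
        rw [← hone]
        refine Finset.sum_congr rfl fun f hf => ?_
        have hfe : f ≠ e := fun h => heb (h ▸ hf)
        simp [Pi.single_eq_of_ne hfe]

/-- Exchange: the symmetric differences of `J` with `P` and with a subset `P'` of `P`. -/
lemma weight_exchange (w : E → ℝ) (J P P' : E → ZMod 2) (h : ∀ e, P' e ≠ 0 → P e ≠ 0) :
    weight w (J + P) + weight w J = weight w (J + P') + weight w (J + (P + P')) := by
  simp only [weight, ← Finset.sum_add_distrib, ← mul_add]
  refine Finset.sum_congr rfl fun e _ => ?_
  have key : ∀ j p p' : ZMod 2, (p' ≠ 0 → p ≠ 0) →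
      (j + p).val + j.val = (j + p').val + (j + (p + p')).val := by decide
  have := key (J e) (P e) (P' e) (h e)
  simp only [Pi.add_apply]
  congr 1
  exact_mod_cast this

/-- Removing an edge of positive weight. -/
lemma weight_add_single_lt (w : E → ℝ) (J : E → ZMod 2) (e : E) (he : J e = 1) (hw : 0 < w e) :
    weight w (J + Pi.single e 1) < weight w J := by
  unfold weight
  refine Finset.sum_lt_sum (fun f _ => ?_) ⟨e, Finset.mem_univ e, ?_⟩
  · by_cases hf : f = e
    · subst hf
      simpa [he, CharTwo.add_self_eq_zero, ZMod.val_one] using hw.le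
    · simp [Pi.single_eq_of_ne hf]
  · simpa [he, CharTwo.add_self_eq_zero, ZMod.val_one] using hw

/-- **Seymour's lemma.** If all non-loops have positive weight and `T ≠ 0`, then there is a node
`u` of `T` at which every minimum weight `T`-join has exactly one edge.

Among all sets `T'` that differ from `T` in at most two nodes, and all `T'`-joins, let `Q` be one of
minimum weight. Then `T'` and `T` differ in two nodes, and `u` is one of them. The set `Q` has no
edge at `u`, as its removal would give a lighter choice. For a minimum `T`-join `J`, the edges of
`J` at `u` are those of the symmetric difference of `J` and `Q`, and this can be taken to be an
`{a, u}`-join with one edge at `u`. -/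
theorem exists_node_forall_min_join (s t : E → W) (w : E → ℝ) (hpos : ∀ e, s e ≠ t e → 0 < w e)
    (T : W → ZMod 2) (hT : T ≠ 0) (J₀ : E → ZMod 2) (hJ₀ : bdry s t J₀ = T) :
    ∃ u, T u = 1 ∧ ∀ J, bdry s t J = T → (∀ J', bdry s t J' = T → weight w J ≤ weight w J') →
      ∑ e ∈ cut s t {u}, (J e).val = 1 := by
  obtain ⟨v₀, hv₀⟩ : ∃ v, T v ≠ 0 := Function.ne_iff.1 hT
  let good : (E → ZMod 2) × W × W → Prop := fun q =>
    bdry s t q.1 + T = Pi.single q.2.1 1 + Pi.single q.2.2 1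
  classical
  obtain ⟨⟨Q, a, b⟩, hQ, hmin⟩ := Finset.exists_min_image (Finset.univ.filter good)
    (fun q => weight w q.1) ⟨(J₀, v₀, v₀), by
      simp only [good, Finset.mem_filter, Finset.mem_univ, true_and, hJ₀, add_self_zmod]⟩
  simp only [good, Finset.mem_filter, Finset.mem_univ, true_and] at hQ hmin
  have hmin' : ∀ (Q' : E → ZMod 2) (a' b' : W), bdry s t Q' + T = Pi.single a' 1 + Pi.single b' 1 →
      weight w Q ≤ weight w Q' := fun Q' a' b' h => hmin (Q', a', b') h
  have hab : a ≠ b := by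
    rintro rfl
    have hQT : bdry s t Q = T := by
      rw [add_self_zmod] at hQ
      have := add_self_zmod T
      linear_combination hQ - this
    have h1 : ∑ e ∈ cut s t {v₀}, Q e ≠ 0 := by rwa [← bdry_apply, hQT]
    obtain ⟨e, he, hQe⟩ := Finset.exists_ne_zero_of_sum_ne_zero h1
    refine absurd (hmin' (Q + Pi.single e 1) (s e) (t e) ?_) (not_le.2
      (weight_add_single_lt w Q e (zmod_two_eq_one hQe) (hpos e (ne_of_mem_cut he))))
    rw [bdry_add, bdry_single, one_smul, hQT]
    have := add_self_zmod T
    linear_combination this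
  have hstar : ∀ Q' : E → ZMod 2, bdry s t Q' + T = Pi.single a 1 + Pi.single b 1 →
      weight w Q' ≤ weight w Q → ∀ e ∈ cut s t {b}, Q' e = 0 := by
    intro Q' hQ' hle e he
    by_contra hne
    obtain ⟨c, -, hc⟩ := mem_cut_singleton_ends he
    have hlt := weight_add_single_lt w Q' e (zmod_two_eq_one hne) (hpos e (ne_of_mem_cut he))
    refine absurd (hmin' (Q' + Pi.single e 1) a c ?_) (not_le.2 (hlt.trans_le hle))
    have hends : (Pi.single (s e) 1 + Pi.single (t e) 1 : W → ZMod 2) =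
        Pi.single b 1 + Pi.single c 1 := by
      rcases hc with ⟨h, h'⟩ | ⟨h, h'⟩ <;> rw [h, h']
      rw [add_comm]
    rw [bdry_add, bdry_single, one_smul, hends]
    have := add_self_zmod (Pi.single b 1 : W → ZMod 2)
    linear_combination hQ' + this
  refine ⟨b, ?_, ?_⟩
  · have h1 : bdry s t Q b = 0 := by
      rw [bdry_apply]
      exact Finset.sum_eq_zero (hstar Q hQ le_rfl)
    have h2 := congrFun hQ b
    simpa [h1, Pi.single_eq_of_ne hab.symm] using h2
  · intro J hJ hJmin
    have hP : bdry s t (J + Q) = Pi.single a 1 + Pi.single b 1 := by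
      rw [bdry_add, hJ, add_comm, hQ]
    obtain ⟨P', hsub, hbd, hone⟩ := exists_subjoin s t (J + Q) a b hab hP
    have hJP : J + (J + Q) = Q := by
      rw [← add_assoc, add_self_zmod, zero_add]
    have hex := weight_exchange w J (J + Q) P' hsub
    rw [hJP] at hex
    have hle : weight w J ≤ weight w (J + (J + Q + P')) := by
      apply hJmin
      rw [bdry_add, bdry_add, hP, hbd, add_self_zmod, add_zero, hJ]
    have hz := hstar (J + P') (by
      rw [bdry_add, hJ, hbd]
      have := add_self_zmod T
      linear_combination this) (by linarith)
    rw [← hone]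
    refine Finset.sum_congr rfl fun e he => ?_
    have h0 : J e + P' e = 0 := hz e he
    rw [CharTwo.add_eq_zero.1 h0]

end Joins

/-! ### The `T`-join polyhedron -/

section JoinPolyhedron

variable {E W : Type*} [Fintype E] [DecidableEq E] [Fintype W] [DecidableEq W]

/-- A join of the multigraph in which the ends of an edge of weight `0` are identified can be
corrected on that edge to become a join of the multigraph itself. -/
lemma exists_join_of_contract {s t : E → W} {w : E → ℝ} {e₀ : E} (h₀ : s e₀ ≠ t e₀)
    (hw : w e₀ = 0) {J J₀ : E → ZMod 2}
    (hJ : bdry (contractMap h₀ ∘ s) (contractMap h₀ ∘ t) J =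
      bdry (contractMap h₀ ∘ s) (contractMap h₀ ∘ t) J₀) :
    ∃ J', bdry s t J' = bdry s t J₀ ∧ weight w J' = weight w J := by
  have hfib : ∀ v' : {v : W // v ≠ t e₀},
      ∑ v with contractMap h₀ v = v', (bdry s t (J + J₀)) v = 0 := by
    intro v'
    have h1 := bdry_apply (contractMap h₀ ∘ s) (contractMap h₀ ∘ t) (J + J₀) v'
    rw [cut_comp, ← sum_bdry, bdry_add, hJ, add_self_zmod] at h1
    simpa using h1.symm
  set k := bdry s t (J + J₀) (t e₀) with hk
  have hD : bdry s t (J + J₀) = k • (Pi.single (s e₀) 1 + Pi.single (t e₀) 1) := by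
    ext v
    have hf := hfib (contractMap h₀ v)
    by_cases hvb : v = t e₀
    · subst hvb
      simp [← hk, Pi.single_eq_of_ne h₀.symm]
    by_cases hva : v = s e₀
    · subst hva
      have : Finset.univ.filter (fun u => contractMap h₀ u = contractMap h₀ (s e₀)) =
          {s e₀, t e₀} := by
        ext u
        simp only [Finset.mem_filter, Finset.mem_univ, true_and, contractMap_eq_iff,
          Finset.mem_insert, Finset.mem_singleton]
        tauto
      rw [this, Finset.sum_pair h₀, CharTwo.add_eq_zero] at hf
      rw [hf]
      simp [← hk, Pi.single_eq_of_ne h₀]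
    · have : Finset.univ.filter (fun u => contractMap h₀ u = contractMap h₀ v) = {v} := by
        ext u
        simp only [Finset.mem_filter, Finset.mem_univ, true_and, contractMap_eq_iff,
          Finset.mem_singleton]
        tauto
      rw [this, Finset.sum_singleton] at hf
      simp [hf, Pi.single_eq_of_ne hva, Pi.single_eq_of_ne hvb]
  refine ⟨J + Pi.single e₀ k, ?_, ?_⟩
  · rw [bdry_add, bdry_single, ← hD, bdry_add]
    have := add_self_zmod (bdry s t J)
    linear_combination this
  · unfold weight
    refine Finset.sum_congr rfl fun e _ => ?_
    by_cases he : e = e₀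
    · subst he
      simp [hw]
    · simp [Pi.single_eq_of_ne he]

lemma weight_sub (w w' : E → ℝ) (J : E → ZMod 2) :
    weight (w - w') J = weight w J - weight w' J := by
  simp [weight, sub_mul]

/-- The weight of `J` when every edge of a set `D` has weight `ε`. -/
lemma weight_indicator (D : Finset E) (ε : ℝ) (J : E → ZMod 2) :
    weight (fun e => if e ∈ D then ε else 0) J = ε * (∑ e ∈ D, (J e).val : ℕ) := by
  simp only [weight, ite_mul, zero_mul, Finset.sum_ite_mem, Finset.univ_inter]
  push_cast
  rw [Finset.mul_sum]

/-- If all non-loops have positive weight, then weights can be lowered by some `ε > 0` on the star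
of a node of `T` without decreasing the gap between the weight of any `T`-join and `w · z`. -/
lemma exists_lower_weights {s t : E → W} {z w : E → ℝ} {T : W → ZMod 2} {J₀ : E → ZMod 2}
    (hJ₀ : bdry s t J₀ = T) (hT : T ≠ 0)
    (hz : ∀ S : Finset W, ∑ v ∈ S, T v = 1 → 1 ≤ ∑ e ∈ cut s t S, z e)
    (hpos : ∀ e, s e ≠ t e → 0 < w e) {δ : ℝ}
    (hδ : ∀ J, bdry s t J = T → δ ≤ weight w J - ∑ e, w e * z e) :
    ∃ (D : Finset E) (ε : ℝ), D.Nonempty ∧ 0 < ε ∧ (∀ e ∈ D, ε ≤ w e) ∧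
      ∀ J, bdry s t J = T → δ ≤ weight (w - fun e => if e ∈ D then ε else 0) J -
        ∑ e, (w - fun e => if e ∈ D then ε else 0) e * z e := by
  classical
  obtain ⟨u, hu, hJu⟩ := exists_node_forall_min_join s t w hpos T hT J₀ hJ₀
  have hzu : 1 ≤ ∑ e ∈ cut s t {u}, z e := hz {u} (by simpa using hu)
  have hDne : (cut s t {u}).Nonempty := by
    by_contra h
    rw [Finset.not_nonempty_iff_eq_empty] at h
    rw [h, Finset.sum_empty] at hzu
    linarith
  obtain ⟨Jm, hJm, hJmin⟩ := Finset.exists_min_image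
    (Finset.univ.filter fun J => bdry s t J = T) (weight w) ⟨J₀, by simpa using hJ₀⟩
  simp only [Finset.mem_filter, Finset.mem_univ, true_and] at hJm hJmin
  -- `g` bounds from below the excess weight of the `T`-joins that are not of minimum weight.
  obtain ⟨g, hg, hgap⟩ : ∃ g > 0, ∀ J, bdry s t J = T → weight w Jm < weight w J →
      weight w Jm + g ≤ weight w J := by
    by_cases hB : (Finset.univ.filter fun J => bdry s t J = T ∧
        weight w Jm < weight w J).Nonempty
    · obtain ⟨K, hK, hKmin⟩ := Finset.exists_min_image _ (weight w) hB
      simp only [Finset.mem_filter, Finset.mem_univ, true_and] at hK hKmin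
      exact ⟨weight w K - weight w Jm, by linarith [hK.2], fun J h1 h2 => by
        linarith [hKmin J ⟨h1, h2⟩]⟩
    · refine ⟨1, one_pos, fun J h1 h2 => (hB ⟨J, ?_⟩).elim⟩
      simp [h1, h2]
  obtain ⟨f, hf, hfmin⟩ := Finset.exists_min_image _ w hDne
  have hwf : 0 < w f := hpos f (ne_of_mem_cut hf)
  have hN : (0 : ℝ) < (cut s t {u}).card := by exact_mod_cast Finset.card_pos.2 hDne
  refine ⟨cut s t {u}, min (w f) (g / (cut s t {u}).card), hDne, lt_min hwf (div_pos hg hN),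
    fun e he => (min_le_left _ _).trans (hfmin e he), fun J hJ => ?_⟩
  set ε := min (w f) (g / (cut s t {u}).card) with hε
  have hε0 : 0 < ε := lt_min hwf (div_pos hg hN)
  have hsum : ∑ e, (w - fun e => if e ∈ cut s t {u} then ε else 0) e * z e =
      ∑ e, w e * z e - ε * ∑ e ∈ cut s t {u}, z e := by
    simp only [Pi.sub_apply, sub_mul, Finset.sum_sub_distrib, ite_mul, zero_mul,
      Finset.sum_ite_mem, Finset.univ_inter, Finset.mul_sum]
  rw [weight_sub, weight_indicator, hsum]
  have hzε : ε ≤ ε * ∑ e ∈ cut s t {u}, z e := le_mul_of_one_le_right hε0.le hzu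
  rcases (hJmin J hJ).eq_or_lt with heq | hlt
  · have h1 := hJu J hJ fun J' hJ' => heq ▸ hJmin J' hJ'
    rw [h1]
    have := hδ J hJ
    push_cast
    linarith
  · have h1 := hgap J hJ hlt
    have h2 : (∑ e ∈ cut s t {u}, (J e).val : ℕ) ≤ (cut s t {u}).card := by
      have : ∀ e ∈ cut s t {u}, (J e).val ≤ 1 := fun e _ => Nat.le_of_lt_succ (ZMod.val_lt (J e))
      simpa using Finset.sum_le_sum this
    have h3 : ε * (∑ e ∈ cut s t {u}, (J e).val : ℕ) ≤ g := by
      calc ε * (∑ e ∈ cut s t {u}, (J e).val : ℕ) ≤ ε * (cut s t {u}).card := by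
            gcongr
        _ ≤ g / (cut s t {u}).card * (cut s t {u}).card := by
            gcongr
            exact min_le_right _ _
        _ = g := div_mul_cancel₀ _ hN.ne'
    have := hδ Jm hJm
    linarith

/-- **The `T`-join polyhedron** (Edmonds and Johnson). If `z ≥ 0` has value at least `1` on every
`T`-cut, then for all weights `w ≥ 0` some `T`-join has weight at most `w · z`.

Among the weights below a counterexample for which all `T`-joins exceed `w · z` by at least the
same amount, take one with the smallest sum. It has no edge of weight `0` that is not a loop, as
that edge could be contracted, and this contradicts `exists_lower_weights`. -/
theorem exists_join_le {W : Type*} [Fintype W] [DecidableEq W]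
    (s t : E → W) (z w : E → ℝ) (hz0 : 0 ≤ z) (hw : 0 ≤ w)
    (J₀ : E → ZMod 2)
    (hz : ∀ S : Finset W, ∑ v ∈ S, bdry s t J₀ v = 1 → 1 ≤ ∑ e ∈ cut s t S, z e) :
    ∃ J, bdry s t J = bdry s t J₀ ∧ weight w J ≤ ∑ e, w e * z e := by
  classical
  obtain ⟨n, hn⟩ : ∃ n, Fintype.card W = n := ⟨_, rfl⟩
  induction n generalizing W w with
  | zero =>
    have : IsEmpty W := Fintype.card_eq_zero_iff.1 hn
    refine ⟨0, Subsingleton.elim _ _, ?_⟩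
    simpa [weight] using Finset.sum_nonneg fun e _ => mul_nonneg (hw e) (hz0 e)
  | succ n ih =>
    by_cases hT : bdry s t J₀ = 0
    · refine ⟨0, by rw [bdry_zero, hT], ?_⟩
      simpa [weight] using Finset.sum_nonneg fun e _ => mul_nonneg (hw e) (hz0 e)
    by_contra! hcon
    obtain ⟨Jm, hJm, hJmin⟩ := Finset.exists_min_image
      (Finset.univ.filter fun J => bdry s t J = bdry s t J₀) (weight w) ⟨J₀, by simp⟩
    simp only [Finset.mem_filter, Finset.mem_univ, true_and] at hJm hJmin
    set δ := weight w Jm - ∑ e, w e * z e with hδdef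
    have hδ0 : 0 < δ := sub_pos.2 (hcon Jm hJm)
    let K : Set (E → ℝ) := Set.Icc 0 w ∩ ⋂ J, ⋂ (_ : bdry s t J = bdry s t J₀),
      {w' | δ ≤ weight w' J - ∑ e, w' e * z e}
    have hKc : IsCompact K := by
      refine isCompact_Icc.inter_right (isClosed_iInter fun J => isClosed_iInter fun _ => ?_)
      unfold weight
      exact isClosed_le (by fun_prop) (by fun_prop)
    have hKmem : ∀ w', w' ∈ K ↔ (0 ≤ w' ∧ w' ≤ w) ∧
        ∀ J, bdry s t J = bdry s t J₀ → δ ≤ weight w' J - ∑ e, w' e * z e := by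
      intro w'
      simp [K]
    have hwK : w ∈ K := (hKmem w).2 ⟨⟨hw, le_rfl⟩, fun J hJ => by
      linarith [hJmin J hJ]⟩
    obtain ⟨w', hw'K, hw'min⟩ := hKc.exists_isMinOn ⟨w, hwK⟩
      (f := fun w' : E → ℝ => ∑ e, w' e) (by fun_prop)
    obtain ⟨⟨hw'0, hw'w⟩, hw'δ⟩ := (hKmem w').1 hw'K
    have hpos : ∀ e, s e ≠ t e → 0 < w' e := by
      intro e₀ h₀
      refine lt_of_le_of_ne (hw'0 e₀) fun h => ?_
      obtain ⟨J, hJ, hJw⟩ := ih (contractMap h₀ ∘ s)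
        (contractMap h₀ ∘ t) w' hw'0 (fun S hS => by
          rw [sum_bdry, cut_comp, ← sum_bdry] at hS
          rw [cut_comp]
          exact hz _ hS) (by have := card_contract (t e₀); omega)
      obtain ⟨J', hJ', hJ'w⟩ := exists_join_of_contract h₀ h.symm hJ
      have := hw'δ J' hJ'
      linarith
    obtain ⟨D, ε, ⟨f, hf⟩, hε, hDε, hlow⟩ := exists_lower_weights rfl hT hz hpos hw'δ
    have hmem : (w' - fun e => if e ∈ D then ε else 0) ∈ K := by
      refine (hKmem _).2 ⟨⟨fun e => ?_, fun e => ?_⟩, hlow⟩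
      · by_cases he : e ∈ D
        · simpa [he] using hDε e he
        · simpa [he] using hw'0 e
      · have := hw'w e
        by_cases he : e ∈ D
        · simp only [Pi.sub_apply, he, if_true]; linarith
        · simpa [he] using this
    have h1 : ∑ e, w' e ≤ ∑ e, (w' - fun e => if e ∈ D then ε else 0) e :=
      isMinOn_iff.1 hw'min _ hmem
    have h2 : ∑ e, (w' - fun e => if e ∈ D then ε else 0) e < ∑ e, w' e := by
      refine Finset.sum_lt_sum (fun e _ => ?_) ⟨f, Finset.mem_univ f, ?_⟩
      · by_cases he : e ∈ D
        · simpa [he] using hε.le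
        · simp [he]
      · simpa [hf] using hε
    linarith

end JoinPolyhedron

/-! ### Tours of bounded cost and the tour polyhedron -/

section CompleteGraph

variable {V : Type*} [Fintype V] [DecidableEq V]

/-- One of the two ends of an edge of the complete graph. -/
noncomputable def src (e : KEdge V) : V := (Quot.out e.1).1

/-- The end of an edge of the complete graph other than `src e`. -/
noncomputable def tgt (e : KEdge V) : V := (Quot.out e.1).2

lemma val_eq (e : KEdge V) : e.1 = s(src e, tgt e) := (Quot.out_eq e.1).symm

lemma src_ne_tgt (e : KEdge V) : src e ≠ tgt e := by
  have := e.2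
  rw [val_eq] at this
  simpa using this

lemma mem_val_iff (e : KEdge V) (v : V) : v ∈ e.1 ↔ v = src e ∨ v = tgt e := by
  rw [val_eq]
  exact Sym2.mem_iff

lemma filter_mem_eq_cut (v : V) :
    (Finset.univ.filter fun e : KEdge V => v ∈ e.1) = cut src tgt {v} := by
  ext e
  have := src_ne_tgt e
  simp only [Finset.mem_filter, Finset.mem_univ, true_and, mem_val_iff, mem_cut,
    Finset.mem_singleton]
  grind

lemma graphOf_adj {P : KEdge V → Prop} {u v : V} :
    (graphOf P).Adj u v ↔ ∃ h : u ≠ v, P ⟨s(u, v), by simpa using h⟩ := by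
  simp only [graphOf, SimpleGraph.fromEdgeSet_adj]
  constructor
  · rintro ⟨⟨_, hP⟩, h⟩
    exact ⟨h, hP⟩
  · rintro ⟨h, hP⟩
    exact ⟨⟨by simpa using h, hP⟩, h⟩

lemma graphOf_adj_src_tgt {P : KEdge V → Prop} {e : KEdge V} (he : P e) :
    (graphOf P).Adj (src e) (tgt e) := by
  refine graphOf_adj.2 ⟨src_ne_tgt e, ?_⟩
  convert he using 1
  exact Subtype.ext (val_eq e).symm

lemma graphOf_connected [Nonempty V] {P : KEdge V → Prop}
    (h : ∀ S : Finset V, S.Nonempty → S ≠ Finset.univ → ∃ e, P e ∧ e ∈ cut src tgt S) :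
    (graphOf P).Connected := by
  classical
  refine SimpleGraph.Connected.mk fun u v => ?_
  by_contra huv
  obtain ⟨e, he, hec⟩ := h (Finset.univ.filter fun w => (graphOf P).Reachable u w)
    ⟨u, by simp⟩ (fun hS => huv (by simpa using Finset.eq_univ_iff_forall.1 hS v))
  have hadj := (graphOf_adj_src_tgt he).reachable
  simp only [mem_cut, Finset.mem_filter, Finset.mem_univ, true_and] at hec
  exact hec ⟨fun h => h.trans hadj, fun h => h.trans hadj.symm⟩

/-- **Christofides' tours.** If `x ≥ 0` has value at least `2` on every cut, then for all costs
`c ≥ 0` some tour costs at most `3/2 c · x`: a cheap connecting set `F`, together with a cheap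
`T`-join, where `T` is the set of nodes of odd degree in `F`. -/
theorem exists_tour_le [Nonempty V] (x c : KEdge V → ℝ) (hx0 : 0 ≤ x) (hc : 0 ≤ c)
    (hx : ∀ S : Finset V, S.Nonempty → S ≠ Finset.univ → 2 ≤ ∑ e ∈ cut src tgt S, x e) :
    ∃ J : KEdge V → ℕ, IsTour J ∧ (∀ e, J e ≤ 2) ∧
      ∑ e, c e * J e ≤ 3 / 2 * ∑ e, c e * x e := by
  classical
  obtain ⟨F, hF, -, -, hFc⟩ := exists_connecting_le src tgt x c hx0 hc hx
  let F' : KEdge V → ZMod 2 := fun e => if e ∈ F then 1 else 0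
  obtain ⟨K, hK, hKc⟩ := exists_join_le src tgt (fun e => x e / 2) c
    (fun e => div_nonneg (hx0 e) zero_le_two) hc F' (by
      intro S hS
      rw [← Finset.sum_div]
      suffices 2 ≤ ∑ e ∈ cut src tgt S, x e by linarith
      apply hx
      · by_contra h
        rw [Finset.not_nonempty_iff_eq_empty] at h
        rw [h, Finset.sum_empty] at hS
        exact zero_ne_one hS
      · rintro rfl
        rw [sum_bdry] at hS
        simp [cut] at hS)
  refine ⟨fun e => (if e ∈ F then 1 else 0) + (K e).val, ⟨?_, ?_⟩, ?_, ?_⟩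
  · refine graphOf_connected fun S hS hS' => ?_
    obtain ⟨e, he, hec⟩ := hF S hS hS'
    exact ⟨e, by simp [he], hec⟩
  · intro v
    rw [filter_mem_eq_cut, ← ZMod.natCast_eq_zero_iff_even]
    have h1 := congrFun hK v
    rw [bdry_apply, bdry_apply, ← CharTwo.add_eq_zero, ← Finset.sum_add_distrib] at h1
    rw [← h1]
    push_cast
    refine Finset.sum_congr rfl fun e _ => ?_
    simp only [F', ZMod.natCast_val, ZMod.cast_id', id_eq]
    ring
  · intro e
    have := ZMod.val_lt (K e)
    dsimp only
    split_ifs <;> omega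
  · have e1 : ∑ e, c e * (((if e ∈ F then 1 else 0) + (K e).val : ℕ) : ℝ) =
        ∑ e ∈ F, c e + weight c K := by
      simp [weight, mul_add, Finset.sum_add_distrib]
    have e2 : ∑ e, c e * (x e / 2) = (∑ e, c e * x e) / 2 := by
      rw [Finset.sum_div]
      exact Finset.sum_congr rfl fun e _ => by ring
    rw [e1]
    rw [e2] at hKc
    linarith

lemma IsTour.add_two {J : KEdge V → ℕ} (hJ : IsTour J) (K : KEdge V → ℕ) :
    IsTour fun e => J e + 2 * K e := by
  refine ⟨hJ.1.mono fun u v h => ?_, fun v => ?_⟩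
  · obtain ⟨hne, h⟩ := graphOf_adj.1 h
    exact graphOf_adj.2 ⟨hne, Nat.add_pos_left h _⟩
  · rw [Finset.sum_add_distrib, ← Finset.mul_sum]
    exact (hJ.2 v).add (even_two_mul _)

/-- The tour polyhedron is closed under increasing coordinates, as edges can be added twice. -/
lemma mem_tourPolyhedron_of_le {k y : KEdge V → ℝ} (hk : k ∈ tourPolyhedron V) (hky : k ≤ y) :
    y ∈ tourPolyhedron V := by
  have hconv : Convex ℝ (tourPolyhedron V) := convex_convexHull ℝ _
  have hone : ∀ (e : KEdge V) (r : ℝ), 0 ≤ r → ∀ p ∈ tourPolyhedron V,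
      p + Pi.single e r ∈ tourPolyhedron V := by
    intro e r hr
    suffices h : tourPolyhedron V ⊆ (fun p => p + Pi.single e r) ⁻¹' tourPolyhedron V from h
    refine convexHull_min ?_ (hconv.translate_preimage_left _)
    rintro _ ⟨J, hJ, rfl⟩
    obtain ⟨m, hm⟩ := exists_nat_gt r
    have hm0 : (0 : ℝ) < m := hr.trans_lt hm
    have h1 : incidenceVector J ∈ tourPolyhedron V := subset_convexHull ℝ _ ⟨J, hJ, rfl⟩
    have h2 : incidenceVector (fun f => J f + 2 * (Pi.single e m : KEdge V → ℕ) f) ∈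
        tourPolyhedron V := subset_convexHull ℝ _ ⟨_, hJ.add_two _, rfl⟩
    have h3 := hconv h1 h2 (a := 1 - r / (2 * m)) (b := r / (2 * m))
      (by
        rw [sub_nonneg, div_le_one (by positivity)]
        linarith) (by positivity) (by ring)
    suffices heq : incidenceVector J + Pi.single e r = (1 - r / (2 * m)) • incidenceVector J +
        (r / (2 * m)) • incidenceVector (fun f => J f + 2 * (Pi.single e m : KEdge V → ℕ) f) by
      rw [Set.mem_preimage, heq]
      exact h3
    ext f
    by_cases hf : f = e
    · subst hf
      simp [incidenceVector]
      field_simp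
      ring
    · simp [incidenceVector, Pi.single_eq_of_ne hf]
      ring
  have hall : ∀ A : Finset (KEdge V), k + ∑ e ∈ A, Pi.single e (y e - k e) ∈ tourPolyhedron V := by
    intro A
    induction A using Finset.induction_on with
    | empty => simpa using hk
    | insert e A he ih =>
      rw [Finset.sum_insert he, add_left_comm, add_comm]
      exact hone e _ (sub_nonneg.2 (hky e)) _ ih
  have h := hall Finset.univ
  rwa [Finset.univ_sum_single (fun e => y e - k e), show (k + fun e => y e - k e) = y by
    ext e; simp] at h

/-- **Duality.** A vector is in the tour polyhedron if no nonnegative cost function makes it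
cheaper than all tours of multiplicities at most `2`. -/
theorem mem_tourPolyhedron_of_forall_cost {y : KEdge V → ℝ}
    (h : ∀ c : KEdge V → ℝ, 0 ≤ c → ∃ J : KEdge V → ℕ, IsTour J ∧ (∀ e, J e ≤ 2) ∧
      ∑ e, c e * J e ≤ ∑ e, c e * y e) :
    y ∈ tourPolyhedron V := by
  let B : Set (KEdge V → ℝ) := incidenceVector '' {J | IsTour J ∧ ∀ e, J e ≤ 2}
  have hBfin : B.Finite :=
    ((Set.finite_Iic (fun _ : KEdge V => 2)).subset fun J hJ => hJ.2).image _
  have hBsub : convexHull ℝ B ⊆ tourPolyhedron V := by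
    refine convexHull_mono ?_
    rintro _ ⟨J, hJ, rfl⟩
    exact ⟨J, hJ.1, rfl⟩
  by_cases hdis : Disjoint (convexHull ℝ B) (Set.Iic y)
  · exfalso
    obtain ⟨f, u, v, hfu, huv, hvf⟩ := geometric_hahn_banach_compact_closed
      (convex_convexHull ℝ B) (hBfin.isCompact_convexHull ℝ) (convex_Iic y) isClosed_Iic hdis
    have hf : ∀ p : KEdge V → ℝ, f p = -∑ e, -f (Pi.single e 1) * p e := by
      intro p
      conv_lhs => rw [← Finset.univ_sum_single p]
      rw [map_sum, ← Finset.sum_neg_distrib]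
      refine Finset.sum_congr rfl fun e _ => ?_
      rw [show (Pi.single e (p e) : KEdge V → ℝ) = p e • Pi.single e 1 by
        rw [← Pi.single_smul]; simp, map_smul, smul_eq_mul]
      ring
    have hc : ∀ e, 0 ≤ -f (Pi.single e 1) := by
      intro e
      by_contra! hneg
      -- Going far down in coordinate `e`, the functional would drop below `v`.
      have h1 := hvf (y - ((f y - v) / f (Pi.single e 1)) • Pi.single e 1) (by
        have h0 := hvf y Set.self_mem_Iic
        intro e'
        have : 0 ≤ (f y - v) / f (Pi.single e 1) := div_nonneg (by linarith) (by linarith)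
        by_cases he : e' = e
        · subst he; simpa using this
        · simp [Pi.single_eq_of_ne he])
      rw [map_sub, map_smul, smul_eq_mul, div_mul_cancel₀ _ (by linarith)] at h1
      linarith
    obtain ⟨J, hJ, hJ2, hJc⟩ := h (fun e => -f (Pi.single e 1)) hc
    have h1 := hfu (incidenceVector J) (subset_convexHull ℝ B ⟨J, ⟨hJ, hJ2⟩, rfl⟩)
    have h2 := hvf y Set.self_mem_Iic
    rw [hf] at h1 h2
    simp only [incidenceVector] at h1
    linarith
  · obtain ⟨k, hk, hky⟩ := Set.not_disjoint_iff.1 hdis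
    exact mem_tourPolyhedron_of_le (hBsub hk) hky

end CompleteGraph

/-! ### Hamiltonian cubic graphs -/

section Hamiltonian

variable {V : Type*} [Fintype V] [DecidableEq V]

lemma exists_adj_of_reachable {G : SimpleGraph V} {u v : V} (h : G.Reachable u v) {S : Finset V}
    (hu : u ∈ S) (hv : v ∉ S) : ∃ a b, G.Adj a b ∧ a ∈ S ∧ b ∉ S := by
  obtain ⟨p⟩ := h
  obtain ⟨d, -, h1, h2⟩ := p.exists_boundary_dart (S : Set V) (by simpa) (by simpa)
  exact ⟨d.fst, d.snd, d.adj, by simpa using h1, by simpa using h2⟩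

lemma mem_cut_mk {u v : V} (h : s(u, v) ∈ (⊤ : SimpleGraph V).edgeSet) {S : Finset V}
    (hu : u ∈ S) (hv : v ∉ S) : (⟨s(u, v), h⟩ : KEdge V) ∈ cut src tgt S := by
  have h1 := val_eq (⟨s(u, v), h⟩ : KEdge V)
  rw [mem_cut]
  rcases Sym2.eq_iff.1 h1 with ⟨h2, h3⟩ | ⟨h2, h3⟩ <;> rw [← h2, ← h3] <;> tauto

/-- In a `3`-edge-connected graph, all cuts have at least `3` edges. -/
lemma three_le_card_cut {G : SimpleGraph V} (hG : G.IsEdgeConnected 3) (S : Finset V)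
    (hS : S.Nonempty) (hS' : S ≠ Finset.univ) (A : Finset (KEdge V))
    (hA : ∀ e ∈ cut src tgt S, e.1 ∈ G.edgeSet → e ∈ A) : 3 ≤ A.card := by
  by_contra! hlt
  obtain ⟨u, hu⟩ := hS
  obtain ⟨v, hv⟩ : ∃ v, v ∉ S := by
    by_contra! h
    exact hS' (Finset.eq_univ_iff_forall.2 h)
  have hreach := hG u v (s := ((A.image Subtype.val : Finset (Sym2 V)) : Set (Sym2 V))) (by
    rw [Set.encard_coe_eq_coe_finsetCard]
    exact_mod_cast lt_of_le_of_lt Finset.card_image_le hlt)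
  obtain ⟨a, b, hab, ha, hb⟩ := exists_adj_of_reachable hreach hu hv
  rw [SimpleGraph.deleteEdges_adj] at hab
  refine hab.2 ?_
  have h : s(a, b) ∈ (⊤ : SimpleGraph V).edgeSet := by simpa using hab.1.ne
  have hmem := hA ⟨s(a, b), h⟩ (mem_cut_mk h ha hb) hab.1
  exact Finset.mem_coe.2 (Finset.mem_image.2 ⟨_, hmem, rfl⟩)

/-- The edges of a walk, as a vector of multiplicities `0` and `1`. -/
def walkVector {G : SimpleGraph V} {a : V} (p : G.Walk a a) : KEdge V → ℕ :=
  fun e => if e.1 ∈ p.edges then 1 else 0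

lemma even_sum_walkVector {G : SimpleGraph V} {a : V} {p : G.Walk a a} (hp : p.IsTrail) (v : V) :
    Even (∑ e : KEdge V with v ∈ e.1, walkVector p e) := by
  have h1 := (hp.even_countP_edges_iff v).2 fun h => (h rfl).elim
  suffices h : ∑ e : KEdge V with v ∈ e.1, walkVector p e =
      p.edges.countP (fun e => decide (v ∈ e)) by rwa [h]
  have h2 : ∀ l : List (Sym2 V), l.Nodup →
      l.countP (fun e => decide (v ∈ e)) = (l.toFinset.filter (fun e => v ∈ e)).card := by
    intro l hl
    have : l.toFinset.filter (fun e => v ∈ e) =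
        (l.filter (fun e => decide (v ∈ e))).toFinset := by
      ext e
      simp
    rw [List.countP_eq_length_filter, this, List.toFinset_card_of_nodup (hl.filter _)]
  rw [h2 _ hp.edges_nodup]
  simp only [walkVector, Finset.sum_boole, Finset.filter_filter, Nat.cast_id]
  refine Finset.card_bij (fun e _ => e.1) ?_ (fun _ _ _ _ h => Subtype.ext h) ?_
  · intro e he
    simpa [and_comm] using he
  · intro e he
    simp only [Finset.mem_filter, List.mem_toFinset] at he
    have : e ∈ (⊤ : SimpleGraph V).edgeSet :=
      SimpleGraph.edgeSet_mono le_top (p.edges_subset_edgeSet he.1)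
    exact ⟨⟨e, this⟩, by simpa [and_comm] using he, rfl⟩

lemma isTour_walkVector {G : SimpleGraph V} {a : V} {p : G.Walk a a}
    (hp : p.IsHamiltonianCycle) : IsTour (walkVector p) := by
  refine ⟨?_, even_sum_walkVector hp.isCycle.isTrail⟩
  have : Nonempty V := ⟨a⟩
  let q := p.transfer (graphOf fun e => 0 < walkVector p e) (by
    intro e he
    induction e using Sym2.ind with
    | _ u v =>
      have hne : u ≠ v := (p.adj_of_mem_edges he).ne
      have h1 : 0 < walkVector p ⟨s(u, v), by simpa using hne⟩ := by simp [walkVector, he]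
      exact (graphOf_adj (P := fun e => 0 < walkVector p e)).2 ⟨hne, h1⟩)
  have hq : ∀ v, (graphOf fun e => 0 < walkVector p e).Reachable a v := by
    intro v
    have hv : v ∈ q.support := by
      rw [SimpleGraph.Walk.support_transfer]
      exact hp.mem_support v
    exact ⟨q.takeUntil v hv⟩
  exact SimpleGraph.Connected.mk fun u v => (hq u).symm.trans (hq v)

/-- The number of edges of a closed trail in a cut is even. -/
lemma even_sum_cut_walkVector {G : SimpleGraph V} {a : V} {p : G.Walk a a} (hp : p.IsTrail)
    (S : Finset V) : Even (∑ e ∈ cut src tgt S, walkVector p e) := by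
  rw [← ZMod.natCast_eq_zero_iff_even, Nat.cast_sum, ← sum_bdry]
  refine Finset.sum_eq_zero fun v _ => ?_
  rw [bdry_apply, ← Nat.cast_sum, ZMod.natCast_eq_zero_iff_even, ← filter_mem_eq_cut]
  exact even_sum_walkVector hp v

open Classical in
/-- The vector that is `1 / 2` on the edges of `p` and `1` on the other edges of `G`. -/
noncomputable def halfVector {G : SimpleGraph V} {a : V} (p : G.Walk a a) : KEdge V → ℝ :=
  fun e => if e.1 ∈ p.edges then 1 / 2 else if e.1 ∈ G.edgeSet then 1 else 0

/-- All cuts have value at least `2`: with `h` edges of the closed trail and `m` other edges, the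
value is `h / 2 + m`, where `h + m ≥ 3` and `h` is even. -/
lemma two_le_cut_halfVector {G : SimpleGraph V} (hG : G.IsEdgeConnected 3) {a : V}
    {p : G.Walk a a} (hp : p.IsTrail) (S : Finset V) (hS : S.Nonempty) (hS' : S ≠ Finset.univ) :
    2 ≤ ∑ e ∈ cut src tgt S, halfVector p e := by
  classical
  set A := (cut src tgt S).filter fun e => e.1 ∈ p.edges with hA
  set B := (cut src tgt S).filter fun e => e.1 ∉ p.edges ∧ e.1 ∈ G.edgeSet with hB
  have h1 : ∑ e ∈ cut src tgt S, halfVector p e = A.card / 2 + B.card := by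
    have : ∀ e, halfVector p e = (if e.1 ∈ p.edges then 1 / 2 else 0) +
        (if e.1 ∉ p.edges ∧ e.1 ∈ G.edgeSet then 1 else 0) := by
      intro e
      unfold halfVector
      split_ifs <;> first | tauto | simp
    simp only [this, Finset.sum_add_distrib, ← Finset.sum_filter, Finset.sum_const, nsmul_eq_mul,
      ← hA, ← hB]
    ring
  have h2 : Even A.card := by
    have := even_sum_cut_walkVector hp S
    simpa [walkVector, Finset.sum_boole, ← hA] using this
  have h3 : 3 ≤ A.card + B.card := by
    refine (three_le_card_cut hG S hS hS' (A ∪ B) ?_).trans (Finset.card_union_le _ _)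
    intro e he heG
    by_cases hep : e.1 ∈ p.edges <;> simp [hA, hB, he, heG, hep]
  have h4 : 4 ≤ A.card + 2 * B.card := by
    obtain ⟨k, hk⟩ := h2
    omega
  rw [h1]
  have : (4 : ℝ) ≤ A.card + 2 * B.card := by exact_mod_cast h4
  linarith

/-- The everywhere `6/7` vector is `3/7` times the Hamiltonian cycle plus `4/7 * 3/2` times the
vector `halfVector`. -/
theorem everywhereVector_mem_of_isHamiltonianCycle {G : SimpleGraph V} (hG : G.IsEdgeConnected 3)
    {a : V} {p : G.Walk a a} (hp : p.IsHamiltonianCycle) :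
    everywhereVector G (6 / 7) ∈ tourPolyhedron V := by
  classical
  have : Nonempty V := ⟨a⟩
  refine mem_tourPolyhedron_of_forall_cost fun c hc => ?_
  have hsplit : ∑ e, c e * everywhereVector G (6 / 7) e =
      3 / 7 * ∑ e, c e * walkVector p e + 4 / 7 * (3 / 2 * ∑ e, c e * halfVector p e) := by
    simp only [Finset.mul_sum, ← Finset.sum_add_distrib]
    refine Finset.sum_congr rfl fun e _ => ?_
    by_cases hep : e.1 ∈ p.edges
    · have heG := p.edges_subset_edgeSet hep
      simp only [everywhereVector, walkVector, halfVector, hep, heG, if_true]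
      push_cast
      ring
    · by_cases heG : e.1 ∈ G.edgeSet
      · simp only [everywhereVector, walkVector, halfVector, hep, heG, if_true, if_false]
        push_cast
        ring
      · simp [everywhereVector, walkVector, halfVector, hep, heG]
  obtain ⟨J, hJ, hJ2, hJc⟩ := exists_tour_le (halfVector p) c (fun e => by
      unfold halfVector
      simp only [Pi.zero_apply]
      split_ifs <;> norm_num) hc
    (two_le_cut_halfVector hG hp.isCycle.isTrail)
  by_cases hle : ∑ e, c e * walkVector p e ≤ ∑ e, c e * everywhereVector G (6 / 7) e
  · refine ⟨walkVector p, isTour_walkVector hp, fun e => ?_, hle⟩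
    unfold walkVector
    split_ifs <;> omega
  · exact ⟨J, hJ, hJ2, by linarith⟩

theorem everywhereVector_mem_tourPolyhedron {G : SimpleGraph V} (hcub : IsCubic G)
    (hG : G.IsEdgeConnected 3) (hham : G.IsHamiltonian) :
    everywhereVector G (6 / 7) ∈ tourPolyhedron V := by
  classical
  obtain ⟨a, p, hp⟩ := hham (by
    intro h1
    obtain ⟨v, -⟩ := Fintype.card_eq_one_iff.1 h1
    have h2 := G.degree_lt_card_verts v
    rw [h1] at h2
    have h3 : G.degree v = 3 := by convert hcub v
    omega)
  exact everywhereVector_mem_of_isHamiltonianCycle hG hp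

end Hamiltonian

/-! ### Fundamental graphs -/

section Fundamental

variable {V : Type*} [Fintype V] [DecidableEq V]

/-- A preconnected graph in which all degrees are `2` is a Hamiltonian cycle. -/
lemma isHamiltonian_of_isCycles {G : SimpleGraph V} (hG : G.IsCycles) (hconn : G.Preconnected)
    (hne : ∀ v, (G.neighborSet v).Nonempty) [Nonempty V] : G.IsHamiltonian := by
  intro _
  let a := Classical.arbitrary V
  obtain ⟨p, hp, hverts⟩ := hG.exists_cycle_toSubgraph_verts_eq_connectedComponentSupp
    (SimpleGraph.ConnectedComponent.connectedComponentMk_mem (G := G) (v := a)) (hne a)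
  refine ⟨a, p, hp, hp.isPath_tail.isHamiltonian_of_mem fun w => ?_⟩
  have hw : w ∈ p.support := by
    rw [← SimpleGraph.Walk.mem_verts_toSubgraph, hverts,
      SimpleGraph.ConnectedComponent.mem_supp_iff, SimpleGraph.ConnectedComponent.eq]
    exact hconn w a
  rw [SimpleGraph.Walk.support_tail_of_not_nil _ hp.not_nil]
  rw [← SimpleGraph.Walk.cons_tail_support, List.mem_cons] at hw
  rcases hw with rfl | hw
  · exact SimpleGraph.Walk.end_mem_tail_support hp.not_nil
  · exact hw

/-- A graph whose components are `4`-cycles has coordinates: the `4`-cycle that contains a node,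
and the position of the node on it. -/
lemma exists_fourCycle_coordinates (B : SimpleGraph V)
    (hB : ∀ c : B.ConnectedComponent, Nonempty (c.toSimpleGraph ≃g SimpleGraph.cycleGraph 4)) :
    ∃ pos : V → Fin 4,
      Function.Bijective (fun v => (B.connectedComponentMk v, pos v)) ∧
      ∀ u v, B.Adj u v ↔ B.connectedComponentMk u = B.connectedComponentMk v ∧
        (pos u - pos v = 1 ∨ pos v - pos u = 1) := by
  obtain ⟨φ⟩ : Nonempty (∀ c : B.ConnectedComponent,
      c.toSimpleGraph ≃g SimpleGraph.cycleGraph 4) := ⟨fun c => (hB c).some⟩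
  have hmem : ∀ v, v ∈ (B.connectedComponentMk v).supp := fun v =>
    SimpleGraph.ConnectedComponent.connectedComponentMk_mem
  have hpos : ∀ (v : V) (c : B.ConnectedComponent) (hv : v ∈ c.supp),
      φ (B.connectedComponentMk v) ⟨v, hmem v⟩ = φ c ⟨v, hv⟩ := by
    rintro v c hv
    obtain rfl : B.connectedComponentMk v = c := hv
    rfl
  refine ⟨fun v => φ (B.connectedComponentMk v) ⟨v, hmem v⟩, ⟨fun u v h => ?_, ?_⟩, fun u v => ?_⟩
  · simp only [Prod.mk.injEq] at h
    have hu : u ∈ (B.connectedComponentMk v).supp := h.1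
    have h2 := h.2
    rw [hpos u _ hu] at h2
    exact congrArg Subtype.val ((φ _).injective h2)
  · rintro ⟨c, i⟩
    have hc : ((φ c).symm i : V) ∈ c.supp := ((φ c).symm i).2
    refine ⟨(φ c).symm i, ?_⟩
    refine Prod.ext hc ?_
    exact (hpos _ c hc).trans ((φ c).apply_symm_apply i)
  · beta_reduce
    constructor
    · intro h
      have hc : B.connectedComponentMk u = B.connectedComponentMk v :=
        SimpleGraph.ConnectedComponent.sound h.reachable
      refine ⟨hc, ?_⟩
      have hu : u ∈ (B.connectedComponentMk v).supp := hc
      rw [hpos u _ hu, ← SimpleGraph.cycleGraph_adj, (φ _).map_adj_iff]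
      exact h
    · rintro ⟨hc, h⟩
      have hu : u ∈ (B.connectedComponentMk v).supp := hc
      rw [hpos u _ hu, ← SimpleGraph.cycleGraph_adj, (φ _).map_adj_iff] at h
      exact h

/-- The two perfect matchings of the `4`-cycle on `Fin 4`, as involutions. -/
def fourPartner (b : Bool) (i : Fin 4) : Fin 4 := if b then ![1, 0, 3, 2] i else ![3, 2, 1, 0] i

/-- The graph consisting of `M` and of one of the two perfect matchings of each `4`-cycle, as chosen
by `σ`, where `pos v` is the position of `v` on its `4`-cycle `cyc v`. -/
def matchingUnion {C : Type*} (M : SimpleGraph V) (cyc : V → C) (pos : V → Fin 4) (σ : C → Bool) :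
    SimpleGraph V where
  Adj u v := M.Adj u v ∨ (cyc u = cyc v ∧ pos v = fourPartner (σ (cyc u)) (pos u))
  symm := ⟨by
    rintro u v (h | ⟨h1, h2⟩)
    · exact Or.inl h.symm
    · have : ∀ b i, i = fourPartner b (fourPartner b i) := by decide
      exact Or.inr ⟨h1.symm, by rw [h2, ← h1]; exact this _ _⟩⟩
  loopless := ⟨by
    rintro v (h | ⟨-, h⟩)
    · exact h.ne rfl
    · have : ∀ b i, i ≠ fourPartner b i := by decide
      exact this _ _ h⟩

section MatchingUnion

variable {C : Type*} {M : SimpleGraph V} {cyc : V → C} {pos : V → Fin 4}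

lemma neighborSet_matchingUnion (hbij : Function.Bijective fun v => (cyc v, pos v))
    (hM : ∀ v, ∃! w, M.Adj v w)
    (hdis : ∀ u v, M.Adj u v → cyc u = cyc v → ∀ b, pos v ≠ fourPartner b (pos u))
    (σ : C → Bool) (v : V) : ((matchingUnion M cyc pos σ).neighborSet v).ncard = 2 := by
  obtain ⟨m, hm, hm'⟩ := hM v
  obtain ⟨w, hw⟩ := hbij.2 (cyc v, fourPartner (σ (cyc v)) (pos v))
  simp only [Prod.mk.injEq] at hw
  have hmw : m ≠ w := by
    rintro rfl
    exact hdis v m hm hw.1.symm _ hw.2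
  have : (matchingUnion M cyc pos σ).neighborSet v = {m, w} := by
    ext z
    simp only [SimpleGraph.mem_neighborSet, matchingUnion, Set.mem_insert_iff,
      Set.mem_singleton_iff]
    constructor
    · rintro (h | ⟨h1, h2⟩)
      · exact Or.inl (hm' z h)
      · exact Or.inr (hbij.1 (Prod.ext (h1.symm.trans hw.1.symm) (h2.trans hw.2.symm)))
    · rintro (rfl | rfl)
      · exact Or.inl hm
      · exact Or.inr ⟨hw.1.symm, hw.2⟩
  rw [this, Set.ncard_pair hmw]

/-- Switching the matching of a `4`-cycle that meets two components of `matchingUnion` keeps all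
connections: if an edge `xy` of the old matching is lost, then `x` and `y` stay connected by the
rest of their cycle, which does not use the other lost edge. -/
lemma reachable_switch [DecidableEq C] (hbij : Function.Bijective fun v => (cyc v, pos v))
    {σ : C → Bool} (hcyc : (matchingUnion M cyc pos σ).IsCycles) {u v : V} (huv : cyc u = cyc v)
    (hnr : ¬(matchingUnion M cyc pos σ).Reachable u v) {x y : V}
    (hxy : (matchingUnion M cyc pos σ).Reachable x y) :
    (matchingUnion M cyc pos (Function.update σ (cyc u) (!σ (cyc u)))).Reachable x y := by
  set K := matchingUnion M cyc pos σ with hK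
  set K' := matchingUnion M cyc pos (Function.update σ (cyc u) (!σ (cyc u))) with hK'
  have hsame : ∀ p q, K.Adj p q → (¬M.Adj p q → cyc p ≠ cyc u) → K'.Adj p q := by
    rintro p q (h | ⟨h1, h2⟩) hne
    · exact Or.inl h
    · by_cases hMpq : M.Adj p q
      · exact Or.inl hMpq
      · refine Or.inr ⟨h1, ?_⟩
        rw [Function.update_of_ne (hne hMpq)]
        exact h2
  have hadj : ∀ x y, K.Adj x y → K'.Reachable x y := by
    intro x y hxy
    by_cases hx : ¬M.Adj x y → cyc x ≠ cyc u
    · exact (hsame x y hxy hx).reachable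
    push Not at hx
    obtain ⟨hMxy, hxu⟩ := hx
    obtain ⟨hxy1, hxy2⟩ := hxy.resolve_left hMxy
    have hdel := hcyc.reachable_deleteEdges hxy
    have hall : ∀ z, (K.deleteEdges {s(x, y)}).Reachable x z → K.Reachable x z ∧
        K'.Reachable x z := by
      intro z hz
      rw [SimpleGraph.reachable_iff_reflTransGen] at hz
      induction hz with
      | refl => exact ⟨.rfl, .rfl⟩
      | @tail p q _ hpq ih =>
        rw [SimpleGraph.deleteEdges_adj] at hpq
        refine ⟨ih.1.trans hpq.1.reachable, ih.2.trans (hsame p q hpq.1 ?_).reachable⟩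
        intro hMpq hpu
        -- Otherwise all four nodes of the `4`-cycle would be reachable from `x`.
        obtain ⟨hpq1, hpq2⟩ := hpq.1.resolve_left hMpq
        have hinj : ∀ a b, cyc a = cyc u → cyc b = cyc u → pos a = pos b → a = b :=
          fun a b ha hb h => hbij.1 (Prod.ext (ha.trans hb.symm) h)
        have hyu : cyc y = cyc u := hxy1.symm.trans hxu
        have hqu : cyc q = cyc u := hpq1.symm.trans hpu
        have hcov : ∀ z, cyc z = cyc u → K.Reachable x z := by
          intro z hz
          have hcases : ∀ (b : Bool) (i j k : Fin 4),
              k = i ∨ k = fourPartner b i ∨ k = j ∨ k = fourPartner b j ∨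
                j = i ∨ j = fourPartner b i := by decide
          rw [hxu] at hxy2
          rw [hpu] at hpq2
          have hpx : pos p ≠ pos x := by
            intro h
            have h1 := hinj p x hpu hxu h
            have h2 := hinj q y hqu hyu (by rw [hpq2, hxy2, h])
            exact hpq.2 (by rw [h1, h2]; rfl)
          have hpy : pos p ≠ fourPartner (σ (cyc u)) (pos x) := by
            intro h
            have h1 := hinj p y hpu hyu (h.trans hxy2.symm)
            have hinv : ∀ b i, fourPartner b (fourPartner b i) = i := by decide
            have h2 := hinj q x hqu hxu (by rw [hpq2, h, hinv])
            exact hpq.2 (by rw [h1, h2]; exact Sym2.eq_swap)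
          rcases hcases (σ (cyc u)) (pos x) (pos p) (pos z) with h | h | h | h | h | h
          · rw [hinj z x hz hxu h]
          · rw [hinj z y hz hyu (h.trans hxy2.symm)]
            exact hxy.reachable
          · rw [hinj z p hz hpu h]
            exact ih.1
          · rw [hinj z q hz hqu (h.trans hpq2.symm)]
            exact ih.1.trans hpq.1.reachable
          · exact (hpx h).elim
          · exact (hpy h).elim
        exact hnr ((hcov u rfl).symm.trans (hcov v huv.symm))
    exact (hall y hdel).2
  rw [SimpleGraph.reachable_iff_reflTransGen] at hxy
  induction hxy with
  | refl => exact .rfl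
  | tail _ h ih => exact ih.trans (hadj _ _ h)

end MatchingUnion

/-- A connected graph that consists of a perfect matching and of disjoint `4`-cycles that cover all
nodes is Hamiltonian. The matching and one of the two perfect matchings of each `4`-cycle form a
`2`-regular graph. A choice with the maximum number of connected pairs of nodes gives a connected
graph, since otherwise switching the matching of a `4`-cycle that meets two components would merge
them. -/
theorem isHamiltonian_of_matching_of_fourCycles [Nonempty V] {M B : SimpleGraph V}
    (hM : ∀ v, ∃! w, M.Adj v w) (hdis : ∀ u v, M.Adj u v → ¬B.Adj u v)
    (hB : ∀ c : B.ConnectedComponent, Nonempty (c.toSimpleGraph ≃g SimpleGraph.cycleGraph 4))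
    (hconn : (M ⊔ B).Preconnected) : (M ⊔ B).IsHamiltonian := by
  classical
  obtain ⟨pos, hbij, hadj⟩ := exists_fourCycle_coordinates B hB
  set cyc := B.connectedComponentMk with hcycdef
  have hpartner : ∀ (b : Bool) (i : Fin 4),
      i - fourPartner b i = 1 ∨ fourPartner b i - i = 1 := by decide
  have hdis' : ∀ u v, M.Adj u v → cyc u = cyc v → ∀ b, pos v ≠ fourPartner b (pos u) := by
    intro u v h hc b hp
    exact hdis u v h ((hadj u v).2 ⟨hc, hp ▸ hpartner b (pos u)⟩)
  have hdeg : ∀ σ v, ((matchingUnion M cyc pos σ).neighborSet v).ncard = 2 :=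
    neighborSet_matchingUnion hbij hM hdis'
  obtain ⟨σ, hσ⟩ := Finite.exists_max fun σ : B.ConnectedComponent → Bool =>
    (Finset.univ.filter fun q : V × V => (matchingUnion M cyc pos σ).Reachable q.1 q.2).card
  have hle : matchingUnion M cyc pos σ ≤ M ⊔ B := by
    rintro u v (h | ⟨h1, h2⟩)
    · exact Or.inl h
    · exact Or.inr ((hadj u v).2 ⟨h1, h2 ▸ hpartner _ _⟩)
  have hcycles : (matchingUnion M cyc pos σ).IsCycles := fun v _ => hdeg σ v
  have hBreach : ∀ u v, B.Adj u v → (matchingUnion M cyc pos σ).Reachable u v := by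
    intro u v huv
    by_contra hnr
    obtain ⟨hc, hp⟩ := (hadj u v).1 huv
    refine absurd (hσ (Function.update σ (cyc u) (!σ (cyc u)))) (not_le.2 ?_)
    refine Finset.card_lt_card ((Finset.ssubset_iff_of_subset ?_).2 ⟨(u, v), ?_, ?_⟩)
    · intro q hq
      simp only [Finset.mem_filter, Finset.mem_univ, true_and] at hq ⊢
      exact reachable_switch hbij hcycles hc hnr hq
    · have hor : ∀ (b : Bool) (i j : Fin 4), (i - j = 1 ∨ j - i = 1) →
          j = fourPartner b i ∨ j = fourPartner (!b) i := by decide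
      rcases hor (σ (cyc u)) _ _ hp with h | h
      · exact (hnr (SimpleGraph.Adj.reachable (Or.inr ⟨hc, h⟩))).elim
      · simp only [Finset.mem_filter, Finset.mem_univ, true_and]
        exact SimpleGraph.Adj.reachable (Or.inr ⟨hc, by rw [Function.update_self]; exact h⟩)
    · simpa using hnr
  have hpre : (matchingUnion M cyc pos σ).Preconnected := by
    intro u v
    have h := hconn u v
    rw [SimpleGraph.reachable_iff_reflTransGen] at h
    induction h with
    | refl => exact .rfl
    | tail _ h ih =>
      rcases h with h | h
      · exact ih.trans (SimpleGraph.Adj.reachable (Or.inl h))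
      · exact ih.trans (hBreach _ _ h)
  refine (isHamiltonian_of_isCycles hcycles hpre fun v => ?_).mono hle
  exact Set.nonempty_of_ncard_ne_zero (by rw [hdeg]; exact two_ne_zero)

/-- The support graph consists of the `1`-edges and of the fractional edges. -/
lemma supportGraph_eq_sup {x : KEdge V → ℝ} (hx : x ∈ subtourPolytope V) :
    supportGraph x = graphOf (fun e => x e = 1) ⊔ fractionalGraph x := by
  ext u v
  rw [SimpleGraph.sup_adj]
  simp only [supportGraph, fractionalGraph, graphOf_adj]
  constructor
  · rintro ⟨h, hpos⟩
    rcases (hx.2.2 ⟨s(u, v), by simpa using h⟩).2.eq_or_lt with h1 | h1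
    · exact Or.inl ⟨h, h1⟩
    · exact Or.inr ⟨h, hpos, h1⟩
  · rintro (⟨h, h1⟩ | ⟨h, h1, -⟩)
    · exact ⟨h, by rw [h1]; exact one_pos⟩
    · exact ⟨h, h1⟩

lemma fractionalGraph_le_supportGraph (x : KEdge V → ℝ) : fractionalGraph x ≤ supportGraph x := by
  intro u v huv
  obtain ⟨h, h1, -⟩ := graphOf_adj.1 huv
  exact graphOf_adj.2 ⟨h, h1⟩

lemma IsBoydCarrPoint.isHamiltonian [Nonempty V] {x : KEdge V → ℝ} (hx : IsBoydCarrPoint x)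
    (hconn : (supportGraph x).Preconnected) : (supportGraph x).IsHamiltonian := by
  obtain ⟨⟨hxS, -, hone⟩, hfour⟩ := hx
  rw [supportGraph_eq_sup hxS] at hconn ⊢
  refine isHamiltonian_of_matching_of_fourCycles (fun v => ?_) (fun u v h h' => ?_) hfour hconn
  · obtain ⟨e, ⟨hv, he⟩, huniq⟩ := hone v
    obtain ⟨w, hw⟩ := hv
    have hne : v ≠ w := by
      have := e.2
      rw [hw] at this
      simpa using this
    refine ⟨w, graphOf_adj.2 ⟨hne, ?_⟩, fun z hz => ?_⟩
    · convert he using 2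
      exact Subtype.ext hw.symm
    · obtain ⟨hvz, hz1⟩ := graphOf_adj.1 hz
      have h1 := congrArg Subtype.val (huniq ⟨s(v, z), by simpa using hvz⟩ ⟨by simp, hz1⟩)
      rw [hw] at h1
      exact Sym2.congr_right.1 h1
  · obtain ⟨_, h1⟩ := graphOf_adj.1 h
    obtain ⟨_, -, h2⟩ := graphOf_adj.1 h'
    exact h2.ne h1

lemma IsCarrVempalaPoint.isHamiltonian {x : KEdge V → ℝ} (hx : IsCarrVempalaPoint x) :
    (supportGraph x).IsHamiltonian := by
  obtain ⟨-, a, p, hp, -⟩ := hx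
  exact SimpleGraph.IsHamiltonian.mono (fractionalGraph_le_supportGraph x) fun _ => ⟨a, p, hp⟩

end Fundamental

end TSP

theorem theorem3 {V : Type*} [Fintype V] [DecidableEq V] [Nonempty V] (G : SimpleGraph V) :
    (TSP.IsCubic G → G.IsEdgeConnected 3 → G.IsHamiltonian →
      TSP.everywhereVector G (6 / 7) ∈ TSP.tourPolyhedron V) ∧
    (TSP.IsFundamentalGraph G → G.IsEdgeConnected 3 →
      TSP.IsCubic G ∧ G.IsHamiltonian ∧
        TSP.everywhereVector G (6 / 7) ∈ TSP.tourPolyhedron V) := by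
  refine ⟨fun hcub hG hham => TSP.everywhereVector_mem_tourPolyhedron hcub hG hham, ?_⟩
  rintro ⟨x, hx, rfl⟩ hG
  have hcub : TSP.IsCubic (TSP.supportGraph x) := by
    rcases hx with hx | hx
    · exact hx.1.2.1
    · exact hx.1.2.1
  have hham : (TSP.supportGraph x).IsHamiltonian := by
    rcases hx with hx | hx
    · exact hx.isHamiltonian (hG.preconnected three_ne_zero)
    · exact hx.isHamiltonian
  exact ⟨hcub, hham, TSP.everywhereVector_mem_tourPolyhedron hcub hG hham⟩
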